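/- Let $\mathsf T$ be an essentially small triangulated category. Call an essentially small triangulated category *locally noetherian* if (i) every object is a finite coproduct of indecomposable objects with local endomorphism rings, and (ii) for every sequence $X_1\xrightarrow{\phi_1}X_2\xrightarrow{\phi_2}X_3\xrightarrow{\phi_3}\cdots$ of non-isomorphisms between indecomposable objects there is some $n$ with $\phi_n\cdots\phi_2\phi_1=0$; and call $\mathsf T$ *locally finite* if both $\mathsf T$ and $\mathsf T^{\mathrm{op}}$ are locally noetherian. For objects $X,Y$ let $\operatorname{Rad}(X,Y)$ be the set of morphisms $\phi\colon X\to Y$ such that $\mathrm{id}_X-\phi'\phi$ is invertible for all $\phi'\colon Y\to X$, let $\operatorname{Rad}^2(X,Y)$ be the set of morphisms of the form $\phi''\phi'$ with $\phi'\in\operatorname{Rad}(X,Z)$ and $\phi''\in\operatorname{Rad}(Z,Y)$ for some object $Z$, and put $\operatorname{Irr}(X,Y)=\operatorname{Rad}(X,Y)/\operatorname{Rad}^2(X,Y)$. The *Auslander–Reiten quiver* of $\mathsf T$ has as vertices the isomorphism classes of indecomposable objects, with an arrow $X\to Y$ if and only if $\operatorname{Irr}(X,Y)\neq 0$. A quiver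 is *connected* if any two of its vertices are joined by an unoriented path (so the empty quiver counts as connected). An additive category $\mathsf C$ is *connected* if, whenever $\mathsf C_1,\mathsf C_2$ are full additive subcategories (closed under isomorphisms) such that every object of $\mathsf C$ is a direct sum of an object of $\mathsf C_1$ and an object of $\mathsf C_2$, and $\operatorname{Hom}(X_1,X_2)=0=\operatorname{Hom}(X_2,X_1)$ for all $X_1\in\mathsf C_1$, $X_2\in\mathsf C_2$, one has $\mathsf C=\mathsf C_1$ or $\mathsf C=\mathsf C_2$. **Proposition 3.5.** Suppose that $\mathsf T$ is locally finite. If $X,Y$ are indecomposable objects of $\mathsf T$ and there is a non-zero morphism $X\to Y$, then there is an oriented path $X\to\cdots\to Y$ (possibly of length zero, when $X\cong Y$) in the Auslander–Reiten quiver of $\mathsf T$. Moreover, the category $\mathsf T$ is connected if and only if its Auslander–Reiten quiver is connected. -/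

import Mathlib

open CategoryTheory CategoryTheory.Limits

universe w v u

namespace ARTheory

instance hasFiniteBiproducts_op (C : Type u) [Category.{v} C] [Preadditive C]
    [HasFiniteBiproducts C] : HasFiniteBiproducts Cᵒᵖ :=
  HasFiniteBiproducts.of_hasFiniteProducts

instance (priority := 50) hasBinaryBiproducts_of_finite (C : Type u) [Category.{v} C]
    [Preadditive C] [HasFiniteBiproducts C] : HasBinaryBiproducts C :=
  hasBinaryBiproducts_of_finite_biproducts C

section LocallyFinite

/-- The composite `X 0 ⟶ X 1 ⟶ ⋯ ⟶ X (n + 1)` of the first `n + 1` morphisms of a sequence. -/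
def seqComp {C : Type u} [Category.{v} C] {X : ℕ → C} (φ : ∀ n, X n ⟶ X (n + 1)) :
    ∀ n, X 0 ⟶ X (n + 1)
  | 0 => φ 0
  | n + 1 => seqComp φ n ≫ φ (n + 1)

/-- A (triangulated) category is locally noetherian if every object is a finite coproduct of
indecomposable objects with local endomorphism rings, and if in every sequence
`X₀ ⟶ X₁ ⟶ X₂ ⟶ ⋯` of non-isomorphisms between indecomposable objects some finite
composite starting at `X₀` vanishes. -/
structure IsLocallyNoetherian (C : Type u) [Category.{v} C] [Preadditive C]
    [HasFiniteBiproducts C] : Prop where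
  exists_decomposition : ∀ X : C, ∃ (n : ℕ) (Y : Fin n → C),
    (∀ i, Indecomposable (Y i) ∧ IsLocalRing (End (Y i))) ∧ Nonempty (X ≅ ⨁ Y)
  exists_seqComp_eq_zero : ∀ (X : ℕ → C) (φ : ∀ n, X n ⟶ X (n + 1)),
    (∀ n, Indecomposable (X n)) → (∀ n, ¬ IsIso (φ n)) → ∃ n, seqComp φ n = 0

/-- A (triangulated) category is locally finite if it and its opposite are locally noetherian. -/
structure IsLocallyFinite (C : Type u) [Category.{v} C] [Preadditive C]
    [HasFiniteBiproducts C] : Prop where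
  isLocallyNoetherian : IsLocallyNoetherian C
  isLocallyNoetherian_op : IsLocallyNoetherian Cᵒᵖ

end LocallyFinite

section Radical

variable {C : Type u} [Category.{v} C] [Preadditive C]

lemma isIso_swap {X Y : C} (f : X ⟶ Y) (g : Y ⟶ X) (h : IsIso (𝟙 X - f ≫ g)) :
    IsIso (𝟙 Y - g ≫ f) := by
  obtain ⟨k, hk₁, hk₂⟩ := h
  have e₁ : f ≫ g ≫ k = k - 𝟙 X := by
    simp only [Preadditive.sub_comp, Category.id_comp, Category.assoc] at hk₁
    rw [← hk₁]; abel
  have e₂ : k ≫ f ≫ g = k - 𝟙 X := by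
    simp only [Preadditive.comp_sub, Category.comp_id] at hk₂
    rw [← hk₂]; abel
  refine ⟨𝟙 Y + g ≫ k ≫ f, ?_, ?_⟩
  · have : g ≫ (f ≫ g ≫ k) ≫ f = g ≫ k ≫ f - g ≫ f := by
      rw [e₁]; simp
    simp only [Category.assoc] at this
    simp [Preadditive.sub_comp, Preadditive.comp_add, this]
  · have : g ≫ (k ≫ f ≫ g) ≫ f = g ≫ k ≫ f - g ≫ f := by
      rw [e₂]; simp
    simp only [Category.assoc] at this
    simp [Preadditive.comp_sub, Preadditive.add_comp, this]

lemma isIso_sub_add {X Y Z : C} (f : X ⟶ Y) (a : Y ⟶ X) (g : X ⟶ Z) (b : Z ⟶ X)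
    (hf : IsIso (𝟙 X - f ≫ a)) (hg : ∀ c : Z ⟶ X, IsIso (𝟙 X - g ≫ c)) :
    IsIso (𝟙 X - (f ≫ a + g ≫ b)) := by
  have h : 𝟙 X - (f ≫ a + g ≫ b)
      = (𝟙 X - g ≫ (b ≫ inv (𝟙 X - f ≫ a))) ≫ (𝟙 X - f ≫ a) := by
    rw [Preadditive.sub_comp]
    simp only [Category.assoc, IsIso.inv_hom_id, Category.comp_id, Category.id_comp]
    abel
  rw [h]
  have := hg (b ≫ inv (𝟙 X - f ≫ a))
  infer_instance

/-- The radical `Rad(X, Y) ⊆ Hom(X, Y)`: the morphisms `φ` such that `id_X - φ'φ` is invertible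
for all `φ' : Y ⟶ X`. -/
def Rad (X Y : C) : AddSubgroup (X ⟶ Y) where
  carrier := {φ | ∀ φ' : Y ⟶ X, IsIso (𝟙 X - φ ≫ φ')}
  zero_mem' φ' := by
    simp only [zero_comp, sub_zero]
    infer_instance
  add_mem' {f g} hf hg φ' := by
    rw [Preadditive.add_comp]
    exact isIso_sub_add f φ' g φ' (hf φ') hg
  neg_mem' {f} hf φ' := by
    have := hf (-φ')
    rwa [Preadditive.comp_neg, ← Preadditive.neg_comp] at this

lemma mem_Rad_iff {X Y : C} (φ : X ⟶ Y) :
    φ ∈ Rad X Y ↔ ∀ φ' : Y ⟶ X, IsIso (𝟙 X - φ ≫ φ') := Iff.rfl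

lemma comp_mem_Rad {X Y Z : C} {f : X ⟶ Y} (hf : f ∈ Rad X Y) (g : Y ⟶ Z) :
    f ≫ g ∈ Rad X Z := fun φ' => by
  simpa using hf (g ≫ φ')

lemma comp_mem_Rad' {X Y Z : C} (f : X ⟶ Y) {g : Y ⟶ Z} (hg : g ∈ Rad Y Z) :
    f ≫ g ∈ Rad X Z := fun φ' => by
  have := isIso_swap _ _ (hg (φ' ≫ f))
  have := isIso_swap (φ' ≫ f) g (by simpa using this)
  have h := isIso_swap φ' (f ≫ g) (by simpa using isIso_swap g (φ' ≫ f) this)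
  exact h

variable [HasFiniteBiproducts C]

lemma lift_mem_Rad {X Y Z : C} {f : X ⟶ Y} {g : X ⟶ Z} (hf : f ∈ Rad X Y) (hg : g ∈ Rad X Z) :
    biprod.lift f g ∈ Rad X (Y ⊞ Z) := fun φ' => by
  have h := isIso_sub_add f (biprod.inl ≫ φ') g (biprod.inr ≫ φ') (hf _) hg
  have e : biprod.lift f g ≫ φ' = f ≫ biprod.inl ≫ φ' + g ≫ biprod.inr ≫ φ' := by
    rw [biprod.lift_eq]; simp
  rwa [e]

lemma desc_mem_Rad {X Y Z : C} {f : X ⟶ Z} {g : Y ⟶ Z} (hf : f ∈ Rad X Z) (hg : g ∈ Rad Y Z) :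
    biprod.desc f g ∈ Rad (X ⊞ Y) Z := by
  rw [biprod.desc_eq]
  exact (Rad _ _).add_mem (comp_mem_Rad' _ hf) (comp_mem_Rad' _ hg)

/-- The square of the radical: the morphisms `φ : X ⟶ Y` admitting a factorisation `φ = φ''φ'`
with `φ' ∈ Rad(X, Z)` and `φ'' ∈ Rad(Z, Y)` for some object `Z`. -/
def RadSq (X Y : C) : AddSubgroup (X ⟶ Y) where
  carrier := {φ | ∃ (Z : C) (φ' : X ⟶ Z) (φ'' : Z ⟶ Y),
    φ' ∈ Rad X Z ∧ φ'' ∈ Rad Z Y ∧ φ' ≫ φ'' = φ}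
  zero_mem' := ⟨X, 0, 0, (Rad _ _).zero_mem, (Rad _ _).zero_mem, by simp⟩
  add_mem' := by
    rintro _ _ ⟨Z, a, b, ha, hb, rfl⟩ ⟨W, c, d, hc, hd, rfl⟩
    exact ⟨Z ⊞ W, biprod.lift a c, biprod.desc b d, lift_mem_Rad ha hc, desc_mem_Rad hb hd,
      by simp⟩
  neg_mem' := by
    rintro _ ⟨Z, a, b, ha, hb, rfl⟩
    exact ⟨Z, -a, b, (Rad _ _).neg_mem ha, hb, by simp⟩

/-- `Irr(X, Y) = Rad(X, Y) / Rad²(X, Y)`. -/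
abbrev Irr (X Y : C) : Type v :=
  Rad X Y ⧸ (RadSq X Y).addSubgroupOf (Rad X Y)

end Radical

section Quiver

variable (C : Type u) [Category.{v} C] [Preadditive C] [HasFiniteBiproducts C]

/-- The indecomposable objects of `C`, up to isomorphism in `C`. -/
def indecSetoid : Setoid {X : C // Indecomposable X} where
  r X Y := Nonempty (X.1 ≅ Y.1)
  iseqv := ⟨fun X => ⟨Iso.refl X.1⟩, fun ⟨e⟩ => ⟨e.symm⟩, fun ⟨e⟩ ⟨e'⟩ => ⟨e.trans e'⟩⟩

/-- The vertices of the Auslander–Reiten quiver: isomorphism classes of indecomposable objects. -/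
def ARQuiver : Type u := Quotient (indecSetoid C)

variable {C}

/-- The isomorphism class of an indecomposable object. -/
def ARQuiver.mk (X : C) (hX : Indecomposable X) : ARQuiver C :=
  Quotient.mk (indecSetoid C) ⟨X, hX⟩

/-- There is a (single) arrow from the class of `X` to the class of `Y` if `Irr(X, Y) ≠ 0`. -/
instance : Quiver (ARQuiver C) where
  Hom x y := PLift (∃ (X Y : C) (hX : Indecomposable X) (hY : Indecomposable Y),
    ARQuiver.mk X hX = x ∧ ARQuiver.mk Y hY = y ∧ Nontrivial (Irr X Y))

/-- A quiver is connected if any two vertices are joined by an unoriented path. -/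
def IsConnectedQuiver (V : Type*) [Quiver V] : Prop :=
  ∀ x y : V, Nonempty (@Quiver.Path (Quiver.Symmetrify V) _ x y)

end Quiver

section Connected

variable {C : Type u} [Category.{v} C] [Preadditive C] [HasFiniteBiproducts C]

/-- A full additive subcategory, given by an isomorphism-closed class of objects. -/
structure IsAdditiveSubcategory (P : ObjectProperty C) : Prop where
  of_iso : ∀ {X Y : C}, (X ≅ Y) → P X → P Y
  zero : ∀ X : C, IsZero X → P X
  biprod : ∀ X Y : C, P X → P Y → P (X ⊞ Y)

/-- A decomposition `C = P × Q` into two full additive subcategories. -/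
structure IsDecomposition (P Q : ObjectProperty C) : Prop where
  left : IsAdditiveSubcategory P
  right : IsAdditiveSubcategory Q
  exists_iso : ∀ X : C, ∃ X₁ X₂ : C, P X₁ ∧ Q X₂ ∧ Nonempty (X ≅ X₁ ⊞ X₂)
  hom_eq_zero : ∀ {X₁ X₂ : C}, P X₁ → Q X₂ → ∀ f : X₁ ⟶ X₂, f = 0
  hom_eq_zero' : ∀ {X₁ X₂ : C}, P X₁ → Q X₂ → ∀ f : X₂ ⟶ X₁, f = 0

variable (C) in
/-- An additive category is connected if in any decomposition `C = P × Q` one of the two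
subcategories is all of `C`. -/
def IsConnectedAdditive : Prop :=
  ∀ P Q : ObjectProperty C, IsDecomposition P Q → (∀ X, P X) ∨ (∀ X, Q X)

end Connected

end ARTheory

/-! Every non-isomorphism between indecomposables is radical, because endomorphism rings are local.
Let `X ⟶ Y` be non-zero and radical. If it lies in the square of the radical, factor it through
radical maps and pass to an indecomposable summand of the middle object on which the composite
survives. Repeating this on the left factor lengthens a non-zero chain of non-isomorphisms ending at
`Y`, so the chain condition on the opposite category stops it. This leaves a map `X ⟶ W` outside the
square, hence an arrow, followed by `W ⟶ Y` with non-zero composite (`exists_not_mem_RadSq`). Now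
continue from `W`, keeping the whole composite from `X` non-zero: the chain condition on the
category itself forces the remaining map to become an isomorphism, which closes the path
(`nonempty_path`).

Hence a non-zero map never leaves a connected component of the quiver, and a component and its
complement split the category. Conversely, an arrow carries a non-zero map, so its ends lie in the
same half of any decomposition. -/

namespace ARTheory

/-! ### Indecomposables with local endomorphism rings, and their retracts -/

section Decomposition

variable {C : Type u} [Category.{v} C] [Preadditive C] [HasFiniteBiproducts C]

/-- Splitting off the first summand of a finite biproduct. -/
noncomputable def biproductFinSuccIso {n : ℕ} (Y : Fin (n + 1) → C) :
    ⨁ Y ≅ Y 0 ⊞ ⨁ fun i : Fin n => Y i.succ where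
  hom := biprod.lift (biproduct.π Y 0) (biproduct.lift fun i => biproduct.π Y i.succ)
  inv := biprod.desc (biproduct.ι Y 0) (biproduct.desc fun i => biproduct.ι Y i.succ)
  hom_inv_id := by
    rw [biprod.lift_desc, biproduct.lift_desc, ← Fin.sum_univ_succ
      (fun i => biproduct.π Y i ≫ biproduct.ι Y i), biproduct.total]
  inv_hom_id := by
    apply biprod.hom_ext'
    · apply biprod.hom_ext
      · simp
      · apply biproduct.hom_ext
        intro j
        simp [biproduct.ι_π_ne _ (Fin.succ_ne_zero j).symm]
    · apply biproduct.hom_ext'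
      intro i
      apply biprod.hom_ext
      · simp [biproduct.ι_π_ne _ (Fin.succ_ne_zero i)]
      · apply biproduct.hom_ext
        intro j
        by_cases h : i = j
        · subst h
          simp
        · simp [biproduct.ι_π_ne _ h,
            biproduct.ι_π_ne _ (fun h' => h (Fin.succ_injective _ h') : i.succ ≠ j.succ)]

lemma isZero_biproduct_fin_zero (Y : Fin 0 → C) : IsZero (⨁ Y) := by
  rw [IsZero.iff_id_eq_zero]
  apply biproduct.hom_ext
  exact fun i => i.elim0

lemma Indecomposable.op {X : C} (hX : Indecomposable X) : Indecomposable (Opposite.op X) := by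
  refine ⟨fun h => hX.1 h.unop, fun A B e => ?_⟩
  have e' := e.trans (biprod.opIso A.unop B.unop).symm
  exact (hX.2 _ _ e'.unop.symm).imp (fun h => h.op) (fun h => h.op)

lemma IsAdditiveSubcategory.biproduct {P : ObjectProperty C} (hP : IsAdditiveSubcategory P) :
    ∀ {n : ℕ} (Y : Fin n → C), (∀ i, P (Y i)) → P (⨁ Y)
  | 0, Y, _ => hP.zero _ (isZero_biproduct_fin_zero Y)
  | _ + 1, Y, hY => hP.of_iso (biproductFinSuccIso Y).symm
      (hP.biprod _ _ (hY 0) (hP.biproduct _ fun i => hY i.succ))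

namespace IsLocallyNoetherian

lemma isAdditiveSubcategory_induction (hC : IsLocallyNoetherian C) {P : ObjectProperty C}
    (hP : IsAdditiveSubcategory P) (h : ∀ X, Indecomposable X → P X) (X : C) : P X := by
  obtain ⟨n, Y, hY, ⟨e⟩⟩ := hC.exists_decomposition X
  exact hP.of_iso e.symm (hP.biproduct Y fun i => h _ (hY i).1)

/-- Indecomposability leaves a single summand in the decomposition of `X`, and the locality of its
endomorphism ring is carried back to `X` by conjugation. -/
lemma isIso_or_isIso (hC : IsLocallyNoetherian C) {X : C} (hX : Indecomposable X) {a b : X ⟶ X}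
    (h : a + b = 𝟙 X) : IsIso a ∨ IsIso b := by
  obtain ⟨n, Y, hY, ⟨e⟩⟩ := hC.exists_decomposition X
  cases n with
  | zero => exact absurd ((isZero_biproduct_fin_zero Y).of_iso e) hX.1
  | succ n =>
    have e' := e.trans (biproductFinSuccIso Y)
    have hW := (hX.2 _ _ e').resolve_left (hY 0).1.1
    let e₀ : X ≅ Y 0 := e'.trans (isoBiprodZero hW).symm
    have := (hY 0).2
    let conj : (X ⟶ X) → End (Y 0) := fun c => e₀.inv ≫ c ≫ e₀.hom
    have key : conj a + conj b = 1 := by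
      change e₀.inv ≫ a ≫ e₀.hom + e₀.inv ≫ b ≫ e₀.hom = 𝟙 _
      rw [← Preadditive.comp_add, ← Preadditive.add_comp, h]
      simp
    have back : ∀ c : X ⟶ X, IsUnit (conj c) → IsIso c := by
      intro c hc
      have : IsIso (e₀.inv ≫ c ≫ e₀.hom) := (isUnit_iff_isIso _).1 hc
      have e₁ : c = e₀.hom ≫ (e₀.inv ≫ c ≫ e₀.hom) ≫ e₀.inv := by simp
      rw [e₁]
      infer_instance
    exact (IsLocalRing.isUnit_or_isUnit_of_add_one key).imp (back a) (back b)

lemma eq_id_or_eq_zero (hC : IsLocallyNoetherian C) {X : C} (hX : Indecomposable X) {e : X ⟶ X}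
    (he : e ≫ e = e) : e = 𝟙 X ∨ e = 0 := by
  rcases hC.isIso_or_isIso hX (add_sub_cancel e (𝟙 X)) with h | h
  · left
    rw [← cancel_epi e, he, Category.comp_id]
  · right
    rw [← cancel_epi (𝟙 X - e)]
    simp [he]

/-- The map `f` is a split monomorphism, so it gives an idempotent of `Y`. This idempotent is the
identity, since otherwise it would vanish and kill `X`. -/
lemma isIso_of_isIso_comp (hC : IsLocallyNoetherian C) {X Y : C} (hX : Indecomposable X)
    (hY : Indecomposable Y) (f : X ⟶ Y) (g : Y ⟶ X) (h : IsIso (f ≫ g)) : IsIso f := by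
  let r := g ≫ inv (f ≫ g)
  have hr : f ≫ r = 𝟙 X := by simp [r, ← Category.assoc]
  rcases hC.eq_id_or_eq_zero hY (e := r ≫ f) (by
    rw [Category.assoc, ← Category.assoc f, hr, Category.id_comp]) with h | h
  · exact ⟨r, hr, h⟩
  · refine absurd ((IsZero.iff_id_eq_zero X).2 ?_) hX.1
    calc 𝟙 X = f ≫ (r ≫ f) ≫ r := by
          rw [Category.assoc, hr, Category.comp_id, hr]
      _ = 0 := by rw [h]; simp

lemma mem_Rad_of_not_isIso (hC : IsLocallyNoetherian C) {X Y : C} (hX : Indecomposable X)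
    (hY : Indecomposable Y) {f : X ⟶ Y} (hf : ¬ IsIso f) : f ∈ Rad X Y := fun g =>
  (hC.isIso_or_isIso hX (add_sub_cancel (f ≫ g) (𝟙 X))).resolve_left
    fun h => hf (hC.isIso_of_isIso_comp hX hY f g h)

/-- A non-zero composite through `Z` remains non-zero on some indecomposable retract of `Z`. -/
lemma exists_retract_comp_ne_zero (hC : IsLocallyNoetherian C) {A Z B : C} (f : A ⟶ Z) (g : Z ⟶ B)
    (h : f ≫ g ≠ 0) : ∃ (W : C) (_ : Indecomposable W) (ρ : Retract W Z),
      (f ≫ ρ.r) ≫ ρ.i ≫ g ≠ 0 := by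
  obtain ⟨n, Y, hY, ⟨e⟩⟩ := hC.exists_decomposition Z
  by_contra! H
  refine h ?_
  have hid : 𝟙 Z = ∑ i, e.hom ≫ biproduct.π Y i ≫ biproduct.ι Y i ≫ e.inv := by
    calc 𝟙 Z = e.hom ≫ (∑ i, biproduct.π Y i ≫ biproduct.ι Y i) ≫ e.inv := by
          rw [biproduct.total, Category.id_comp, e.hom_inv_id]
      _ = _ := by simp only [Preadditive.comp_sum, Preadditive.sum_comp, Category.assoc]
  rw [← Category.id_comp g, hid, Preadditive.sum_comp, Preadditive.comp_sum]
  refine Finset.sum_eq_zero fun i _ => ?_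
  simpa using H (Y i) (hY i).1
    { i := biproduct.ι Y i ≫ e.inv
      r := e.hom ≫ biproduct.π Y i
      retract := by simp }

/-- The identity of `Z` is the sum of its parts through `X` and through `Y`; by locality one of them
is invertible. -/
lemma retract_biprod (hC : IsLocallyNoetherian C) {Z X Y : C} (hZ : Indecomposable Z)
    (ρ : Retract Z (X ⊞ Y)) : Nonempty (Retract Z X) ∨ Nonempty (Retract Z Y) := by
  have h : (ρ.i ≫ biprod.fst) ≫ biprod.inl ≫ ρ.r + (ρ.i ≫ biprod.snd) ≫ biprod.inr ≫ ρ.r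
      = 𝟙 Z := by
    calc _ = ρ.i ≫ (biprod.fst ≫ biprod.inl + biprod.snd ≫ biprod.inr) ≫ ρ.r := by
          simp only [Preadditive.comp_add, Preadditive.add_comp, Category.assoc]
      _ = 𝟙 Z := by rw [biprod.total, Category.id_comp, ρ.retract]
  have key : ∀ {A : C} (s : Z ⟶ A) (t : A ⟶ Z), IsIso (s ≫ t) → Nonempty (Retract Z A) :=
    fun s t _ => ⟨⟨s, t ≫ inv (s ≫ t), by simp [← Category.assoc]⟩⟩
  exact (hC.isIso_or_isIso hZ h).imp (key _ _) (key _ _)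

lemma nonempty_iso_of_retract (hC : IsLocallyNoetherian C) {Z X : C} (hZ : Indecomposable Z)
    (hX : Indecomposable X) (ρ : Retract Z X) : Nonempty (Z ≅ X) := by
  have := hC.isIso_of_isIso_comp hZ hX ρ.i ρ.r (by rw [ρ.retract]; infer_instance)
  exact ⟨asIso ρ.i⟩

end IsLocallyNoetherian

end Decomposition

/-! ### Chain conditions and oriented paths -/

section Paths

variable {C : Type u} [Category.{v} C] [Preadditive C]

lemma not_isIso_of_mem_Rad {X Y : C} (hX : ¬ IsZero X) {f : X ⟶ Y} (hf : f ∈ Rad X Y) :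
    ¬ IsIso f := fun _ => by
  have h := hf (inv f)
  rw [IsIso.hom_inv_id, sub_self] at h
  exact hX ((IsZero.iff_id_eq_zero X).2 ((cancel_epi (0 : X ⟶ X)).1 (by simp)))

variable [HasFiniteBiproducts C]

/-- The non-zero morphisms from `A` to indecomposable objects. -/
structure NonzeroFrom (A : C) where
  obj : C
  indecomposable : Indecomposable obj
  hom : A ⟶ obj
  hom_ne_zero : hom ≠ 0

/-- `y` is obtained from `x` by composing with a non-isomorphism. -/
def NonzeroFrom.Rel {A : C} (y x : NonzeroFrom A) : Prop :=
  ∃ f : x.obj ⟶ y.obj, ¬ IsIso f ∧ x.hom ≫ f = y.hom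

/-- This is the chain condition as an induction principle: along an infinite descending chain some
finite composite would vanish, although it carries the first map to a later non-zero one. -/
lemma IsLocallyNoetherian.wellFounded_rel (hC : IsLocallyNoetherian C) (A : C) :
    WellFounded (NonzeroFrom.Rel (A := A)) := by
  rw [wellFounded_iff_isEmpty_descending_chain]
  refine ⟨fun ⟨s, hs⟩ => ?_⟩
  choose φ hφ hcomp using hs
  obtain ⟨n, hn⟩ := hC.exists_seqComp_eq_zero (fun n => (s n).obj) φ
    (fun n => (s n).indecomposable) hφ
  have key : ∀ m, (s 0).hom ≫ seqComp φ m = (s (m + 1)).hom := by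
    intro m
    induction m with
    | zero => exact hcomp 0
    | succ m ih => rw [seqComp, ← Category.assoc, ih, hcomp]
  exact (s (n + 1)).hom_ne_zero (by rw [← key, hn, comp_zero])

lemma nontrivial_Irr {X Y : C} {f : X ⟶ Y} (hf : f ∈ Rad X Y) (hf' : f ∉ RadSq X Y) :
    Nontrivial (Irr X Y) :=
  ⟨QuotientAddGroup.mk ⟨f, hf⟩, 0, fun h => hf' <| by
    rwa [QuotientAddGroup.eq_zero_iff, AddSubgroup.mem_addSubgroupOf] at h⟩

lemma exists_ne_zero_of_nontrivial_Irr {X Y : C} (h : Nontrivial (Irr X Y)) :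
    ∃ f : X ⟶ Y, f ≠ 0 := by
  by_contra! H
  obtain ⟨a, b, hab⟩ := h
  refine hab ?_
  obtain ⟨a, rfl⟩ := QuotientAddGroup.mk_surjective a
  obtain ⟨b, rfl⟩ := QuotientAddGroup.mk_surjective b
  exact congrArg _ (Subtype.ext ((H a.1).trans (H b.1).symm))

/-- A radical morphism `f` with `χ ≫ f ≫ τ ≠ 0` can be replaced by a morphism outside of the
square of the radical. -/
lemma IsLocallyFinite.exists_not_mem_RadSq (hC : IsLocallyFinite C) {V X Y : C}
    (χ : V ⟶ X) (t : NonzeroFrom (Opposite.op Y))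
    (f : X ⟶ t.obj.unop) (hf : f ∈ Rad X t.obj.unop) (h : χ ≫ f ≫ t.hom.unop ≠ 0) :
    ∃ (W : C) (_ : Indecomposable W) (α : X ⟶ W) (ψ : W ⟶ Y),
      α ∈ Rad X W ∧ α ∉ RadSq X W ∧ χ ≫ α ≫ ψ ≠ 0 := by
  -- Read in the opposite category, `t` is a non-zero map from an indecomposable to `Y`; the
  -- induction lengthens it on the left.
  induction t using (hC.isLocallyNoetherian_op.wellFounded_rel (Opposite.op Y)).induction with
  | _ t ih =>
  have hT : Indecomposable t.obj.unop := by
    refine ⟨fun hz => t.indecomposable.1 hz.op, fun A B e => ?_⟩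
    have e' : t.obj ≅ Opposite.op A ⊞ Opposite.op B :=
      (e.symm.op).trans (biprod.opIso A B)
    exact (t.indecomposable.2 _ _ e').imp (fun h => h.unop) (fun h => h.unop)
  by_cases hf' : f ∈ RadSq X t.obj.unop
  · obtain ⟨Z, a, b, ha, hb, rfl⟩ := hf'
    obtain ⟨W, hW, ρ, hρ⟩ := hC.isLocallyNoetherian.exists_retract_comp_ne_zero (χ ≫ a)
      (b ≫ t.hom.unop) (by simpa using h)
    have hτ : (ρ.i ≫ b) ≫ t.hom.unop ≠ 0 := by
      intro h0
      rw [Category.assoc] at h0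
      exact hρ (by rw [h0, comp_zero])
    let t' : NonzeroFrom (Opposite.op Y) :=
      { obj := Opposite.op W
        indecomposable := Indecomposable.op hW
        hom := ((ρ.i ≫ b) ≫ t.hom.unop).op
        hom_ne_zero := fun h0 => hτ (by simpa using congrArg Quiver.Hom.unop h0) }
    have hrad : ρ.i ≫ b ∈ Rad W t.obj.unop := comp_mem_Rad' _ hb
    -- The new `f` is the part of `a` landing in `W`; the rest, `ρ.i ≫ b`, is radical, hence a
    -- non-isomorphism, and is absorbed into the tail.
    refine ih t' ⟨(ρ.i ≫ b).op, fun hi => ?_, rfl⟩ (a ≫ ρ.r) (comp_mem_Rad ha _) ?_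
    · exact not_isIso_of_mem_Rad hW.1 hrad ((isIso_op_iff _).1 hi)
    · simpa [t'] using hρ
  · exact ⟨_, hT, f, t.hom.unop, hf, hf', h⟩

lemma ARQuiver.mk_eq_of_iso {X Y : C} (hX : Indecomposable X) (hY : Indecomposable Y)
    (e : X ≅ Y) : ARQuiver.mk X hX = ARQuiver.mk Y hY :=
  Quotient.sound ⟨e⟩

/-- In a locally finite category, a non-zero morphism between indecomposable objects gives rise to
an oriented path in the Auslander–Reiten quiver. -/
lemma IsLocallyFinite.nonempty_path (hC : IsLocallyFinite C) {X Y : C} (hX : Indecomposable X)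
    (hY : Indecomposable Y) {φ : X ⟶ Y} (hφ : φ ≠ 0) :
    Nonempty (Quiver.Path (ARQuiver.mk X hX) (ARQuiver.mk Y hY)) := by
  -- The induction remembers the composite from `X` to the current vertex, since the chain condition
  -- concerns composites from a fixed start.
  suffices H : ∀ (s : NonzeroFrom X) (ψ : s.obj ⟶ Y), s.hom ≫ ψ ≠ 0 →
      Nonempty (Quiver.Path (ARQuiver.mk s.obj s.indecomposable) (ARQuiver.mk Y hY)) by
    refine H ⟨X, hX, 𝟙 X, fun h => hX.1 ((IsZero.iff_id_eq_zero X).2 h)⟩ φ ?_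
    exact fun h => hφ ((Category.id_comp φ).symm.trans h)
  intro s
  induction s using (hC.isLocallyNoetherian.wellFounded_rel X).induction with
  | _ s ih =>
  intro ψ hψ
  by_cases hi : IsIso ψ
  · rw [ARQuiver.mk_eq_of_iso s.indecomposable hY (asIso ψ)]
    exact ⟨Quiver.Path.nil⟩
  · obtain ⟨W, hW, α, ψ', hα, hα', h⟩ := hC.exists_not_mem_RadSq s.hom
      ⟨Opposite.op Y, Indecomposable.op hY, 𝟙 _, fun h =>
        (Indecomposable.op hY).1 ((IsZero.iff_id_eq_zero _).2 h)⟩ ψ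
      (hC.isLocallyNoetherian.mem_Rad_of_not_isIso s.indecomposable hY hi) (by simpa using hψ)
    rw [← Category.assoc] at h
    obtain ⟨p⟩ := ih ⟨W, hW, s.hom ≫ α, fun h0 => h (by rw [h0, zero_comp])⟩
      ⟨α, not_isIso_of_mem_Rad s.indecomposable.1 hα, rfl⟩ ψ' h
    have a : ARQuiver.mk s.obj s.indecomposable ⟶ ARQuiver.mk W hW :=
      ⟨_, _, s.indecomposable, hW, rfl, rfl, nontrivial_Irr hα hα'⟩
    exact ⟨a.toPath.comp p⟩

end Paths

/-! ### Components of the quiver and decompositions of the category -/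

section Connectedness

variable {C : Type u} [Category.{v} C] [Preadditive C] [HasFiniteBiproducts C]

/-- The objects all of whose indecomposable retracts have their class in `S`. -/
def retractsIn (S : Set (ARQuiver C)) : ObjectProperty C := fun X =>
  ∀ (Z : C) (hZ : Indecomposable Z), Nonempty (Retract Z X) → ARQuiver.mk Z hZ ∈ S

/-- Membership is tested on all indecomposable retracts, so closure under biproducts follows from
`retract_biprod`, with no uniqueness of decompositions. -/
lemma IsLocallyNoetherian.isAdditiveSubcategory_retractsIn (hC : IsLocallyNoetherian C)
    (S : Set (ARQuiver C)) : IsAdditiveSubcategory (retractsIn S) where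
  of_iso e h Z hZ := fun ⟨ρ⟩ => h Z hZ ⟨ρ.trans (Retract.ofIso e.symm)⟩
  zero X hX Z hZ := fun ⟨ρ⟩ => absurd
    ((IsZero.iff_id_eq_zero Z).2 (by rw [← ρ.retract, hX.eq_of_tgt ρ.i 0, zero_comp])) hZ.1
  biprod X Y hX hY Z hZ := fun ⟨ρ⟩ => (hC.retract_biprod hZ ρ).elim (hX Z hZ) (hY Z hZ)

lemma IsLocallyNoetherian.retractsIn_iff (hC : IsLocallyNoetherian C) (S : Set (ARQuiver C))
    {X : C} (hX : Indecomposable X) : retractsIn S X ↔ ARQuiver.mk X hX ∈ S := by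
  refine ⟨fun h => h X hX ⟨Retract.refl X⟩, fun h Z hZ ⟨ρ⟩ => ?_⟩
  obtain ⟨e⟩ := hC.nonempty_iso_of_retract hZ hX ρ
  rwa [ARQuiver.mk_eq_of_iso hZ hX e]

/-- A non-zero map stays non-zero after restriction to an indecomposable retract of the source and
projection to one of the target. -/
lemma IsLocallyNoetherian.hom_eq_zero_of_retractsIn (hC : IsLocallyNoetherian C)
    {S S' : Set (ARQuiver C)}
    (H : ∀ (X Y : C) (hX : Indecomposable X) (hY : Indecomposable Y) (f : X ⟶ Y),
      ARQuiver.mk X hX ∈ S → ARQuiver.mk Y hY ∈ S' → f = 0)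
    {X Y : C} (hX : retractsIn S X) (hY : retractsIn S' Y) (f : X ⟶ Y) : f = 0 := by
  by_contra hf
  obtain ⟨Z, hZ, ρ, hρ⟩ := hC.exists_retract_comp_ne_zero (𝟙 X) f (by simpa using hf)
  obtain ⟨W, hW, σ, hσ⟩ := hC.exists_retract_comp_ne_zero (ρ.i ≫ f) (𝟙 Y) (fun h =>
    hρ (by rw [Category.comp_id] at h; rw [h, comp_zero]))
  refine hσ ?_
  rw [H Z W hZ hW ((ρ.i ≫ f) ≫ σ.r) (hX Z hZ ⟨ρ⟩) (hY W hW ⟨σ⟩), zero_comp]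

/-- The canonical isomorphism `(A ⊞ B) ⊞ (A' ⊞ B') ≅ (A ⊞ A') ⊞ (B ⊞ B')`. -/
noncomputable def biprodBiprodComm (A B A' B' : C) :
    (A ⊞ B) ⊞ (A' ⊞ B') ≅ (A ⊞ A') ⊞ (B ⊞ B') where
  hom := biprod.lift (biprod.map biprod.fst biprod.fst) (biprod.map biprod.snd biprod.snd)
  inv := biprod.lift (biprod.map biprod.fst biprod.fst) (biprod.map biprod.snd biprod.snd)
  hom_inv_id := by
    apply biprod.hom_ext <;> apply biprod.hom_ext <;> simp
  inv_hom_id := by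
    apply biprod.hom_ext <;> apply biprod.hom_ext <;> simp

/-- By `hS` the set `S` is a union of components, and a non-zero map between indecomposables across
it would yield a path across it. -/
lemma IsLocallyFinite.isDecomposition_retractsIn (hC : IsLocallyFinite C) (S : Set (ARQuiver C))
    (hS : ∀ x y : ARQuiver C, Nonempty (Quiver.Path x y) → (x ∈ S ↔ y ∈ S)) :
    IsDecomposition (retractsIn S) (retractsIn Sᶜ) where
  left := hC.isLocallyNoetherian.isAdditiveSubcategory_retractsIn S
  right := hC.isLocallyNoetherian.isAdditiveSubcategory_retractsIn Sᶜ
  exists_iso := by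
    have hS := hC.isLocallyNoetherian.isAdditiveSubcategory_retractsIn S
    have hS' := hC.isLocallyNoetherian.isAdditiveSubcategory_retractsIn Sᶜ
    refine hC.isLocallyNoetherian.isAdditiveSubcategory_induction
      (P := fun X => ∃ X₁ X₂ : C, retractsIn S X₁ ∧ retractsIn Sᶜ X₂ ∧ Nonempty (X ≅ X₁ ⊞ X₂))
      { of_iso := ?_, zero := ?_, biprod := ?_ } ?_
    · rintro X Y e ⟨X₁, X₂, h₁, h₂, ⟨e'⟩⟩
      exact ⟨X₁, X₂, h₁, h₂, ⟨e.symm.trans e'⟩⟩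
    · exact fun X hX => ⟨X, X, hS.zero X hX, hS'.zero X hX, ⟨isoBiprodZero hX⟩⟩
    · rintro X Y ⟨X₁, X₂, h₁, h₂, ⟨e⟩⟩ ⟨Y₁, Y₂, h₁', h₂', ⟨e'⟩⟩
      exact ⟨X₁ ⊞ Y₁, X₂ ⊞ Y₂, hS.biprod _ _ h₁ h₁', hS'.biprod _ _ h₂ h₂',
        ⟨(biprod.mapIso e e').trans (biprodBiprodComm _ _ _ _)⟩⟩
    · intro X hX
      let O : C := ⨁ (Fin.elim0 : Fin 0 → C)
      have hO : IsZero O := isZero_biproduct_fin_zero _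
      by_cases h : ARQuiver.mk X hX ∈ S
      · exact ⟨X, O, (hC.isLocallyNoetherian.retractsIn_iff S hX).2 h, hS'.zero O hO,
          ⟨isoBiprodZero hO⟩⟩
      · exact ⟨O, X, hS.zero O hO, (hC.isLocallyNoetherian.retractsIn_iff Sᶜ hX).2 h,
          ⟨isoZeroBiprod hO⟩⟩
  hom_eq_zero hX hY f := by
    refine hC.isLocallyNoetherian.hom_eq_zero_of_retractsIn (fun X Y hX hY f h h' => ?_) hX hY f
    by_contra hf
    exact h' ((hS _ _ (hC.nonempty_path hX hY hf)).1 h)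
  hom_eq_zero' hX hY f := by
    refine hC.isLocallyNoetherian.hom_eq_zero_of_retractsIn (fun X Y hX hY f h h' => ?_) hY hX f
    by_contra hf
    exact h ((hS _ _ (hC.nonempty_path hX hY hf)).2 h')

lemma nonempty_symmetrify_path {V : Type*} [Quiver V] {x y : V} (h : Nonempty (Quiver.Path x y)) :
    Nonempty (@Quiver.Path (Quiver.Symmetrify V) _ x y) :=
  h.map (Quiver.Symmetrify.of).mapPath

lemma IsLocallyFinite.isConnectedQuiver (hC : IsLocallyFinite C) (h : IsConnectedAdditive C) :
    IsConnectedQuiver (ARQuiver C) := by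
  intro x y
  let S : Set (ARQuiver C) :=
    {z | Nonempty (@Quiver.Path (Quiver.Symmetrify (ARQuiver C)) _ x z)}
  have hS : ∀ y z : ARQuiver C, Nonempty (Quiver.Path y z) → (y ∈ S ↔ z ∈ S) := by
    intro y z hyz
    obtain ⟨p⟩ := nonempty_symmetrify_path hyz
    exact ⟨fun ⟨q⟩ => ⟨q.comp p⟩, fun ⟨q⟩ => ⟨q.comp p.reverse⟩⟩
  have hx : x ∈ S := ⟨@Quiver.Path.nil (Quiver.Symmetrify (ARQuiver C)) _ x⟩
  -- Here `S` is the component of `x`. Either every indecomposable has its class in `S`, in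
  -- particular `y`, or none does, contradicting `hx`.
  rcases h _ _ (hC.isDecomposition_retractsIn S hS) with h | h
  · induction y using Quotient.inductionOn with
    | _ Y => exact (hC.isLocallyNoetherian.retractsIn_iff S Y.2).1 (h Y.1)
  · induction x using Quotient.inductionOn with
    | _ X => exact absurd hx ((hC.isLocallyNoetherian.retractsIn_iff Sᶜ X.2).1 (h X.1))

namespace IsDecomposition

variable {P Q : ObjectProperty C}

lemma or_of_indecomposable (h : IsDecomposition P Q) {X : C} (hX : Indecomposable X) :
    P X ∨ Q X := by
  obtain ⟨X₁, X₂, h₁, h₂, ⟨e⟩⟩ := h.exists_iso X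
  rcases hX.2 _ _ e with hz | hz
  · exact Or.inr (h.right.of_iso (e.trans (isoZeroBiprod hz).symm).symm h₂)
  · exact Or.inl (h.left.of_iso (e.trans (isoBiprodZero hz).symm).symm h₁)

lemma left_of_hom_ne_zero (h : IsDecomposition P Q) {X Y : C} (hX : P X)
    (hY : Indecomposable Y) (hXY : (∃ f : X ⟶ Y, f ≠ 0) ∨ ∃ f : Y ⟶ X, f ≠ 0) : P Y := by
  refine (h.or_of_indecomposable hY).resolve_right fun hQ => ?_
  rcases hXY with ⟨f, hf⟩ | ⟨f, hf⟩
  · exact hf (h.hom_eq_zero hX hQ f)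
  · exact hf (h.hom_eq_zero' hX hQ f)

/-- The vertices whose objects belong to the left part are closed under unoriented paths. -/
lemma left_of_symmetrify_path (h : IsDecomposition P Q) {x y : ARQuiver C}
    (p : @Quiver.Path (Quiver.Symmetrify (ARQuiver C)) _ x y)
    (hx : ∃ (X : C) (hX : Indecomposable X), ARQuiver.mk X hX = x ∧ P X) :
    ∃ (Y : C) (hY : Indecomposable Y), ARQuiver.mk Y hY = y ∧ P Y := by
  induction p with
  | nil => exact hx
  | cons _ a ih =>
    obtain ⟨Y, hY, rfl, hPY⟩ := ih
    -- The arrow is traversed forwards or backwards. Its representatives are only isomorphic to the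
    -- chosen `Y`, so membership is transported along `i`.
    rcases a with ⟨⟨A, B, hA, hB, e, rfl, hI⟩⟩ | ⟨⟨A, B, hA, hB, rfl, e, hI⟩⟩
    · obtain ⟨i⟩ := Quotient.exact e
      exact ⟨B, hB, rfl, h.left_of_hom_ne_zero (h.left.of_iso i.symm hPY) hB
        (Or.inl (exists_ne_zero_of_nontrivial_Irr hI))⟩
    · obtain ⟨i⟩ := Quotient.exact e
      exact ⟨A, hA, rfl, h.left_of_hom_ne_zero (h.left.of_iso i.symm hPY) hA
        (Or.inr (exists_ne_zero_of_nontrivial_Irr hI))⟩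

end IsDecomposition

lemma IsLocallyNoetherian.isConnectedAdditive (hC : IsLocallyNoetherian C)
    (h : IsConnectedQuiver (ARQuiver C)) : IsConnectedAdditive C := by
  intro P Q hPQ
  -- One indecomposable in `P` pulls in all others by connectedness; if there is none, all of them
  -- lie in `Q`.
  by_cases hP : ∃ (X : C) (hX : Indecomposable X), P X
  · obtain ⟨X, hX, hPX⟩ := hP
    refine Or.inl (hC.isAdditiveSubcategory_induction hPQ.left fun Y hY => ?_)
    obtain ⟨p⟩ := h (ARQuiver.mk X hX) (ARQuiver.mk Y hY)
    obtain ⟨Y', hY', e, hPY'⟩ := hPQ.left_of_symmetrify_path p ⟨X, hX, rfl, hPX⟩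
    obtain ⟨i⟩ := Quotient.exact e
    exact hPQ.left.of_iso i hPY'
  · exact Or.inr (hC.isAdditiveSubcategory_induction hPQ.right fun Y hY =>
      (hPQ.or_of_indecomposable hY).resolve_left fun hPY => hP ⟨Y, hY, hPY⟩)

end Connectedness

end ARTheory

theorem proposition3p5 (T : Type u) [Category.{v} T] [Preadditive T] [HasZeroObject T]
    [HasShift T ℤ] [∀ n : ℤ, (shiftFunctor T n).Additive] [Pretriangulated T]
    [IsTriangulated T] [EssentiallySmall.{w} T] (hT : ARTheory.IsLocallyFinite T) :
    (∀ (X Y : T) (hX : Indecomposable X) (hY : Indecomposable Y) (φ : X ⟶ Y), φ ≠ 0 →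
      Nonempty (Quiver.Path (ARTheory.ARQuiver.mk X hX) (ARTheory.ARQuiver.mk Y hY))) ∧
    (ARTheory.IsConnectedAdditive T ↔ ARTheory.IsConnectedQuiver (ARTheory.ARQuiver T)) := by
  exact ⟨fun X Y hX hY φ hφ => hT.nonempty_path hX hY hφ,
    hT.isConnectedQuiver, hT.isLocallyNoetherian.isConnectedAdditive⟩
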